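/- Let $m,n\ge 1$ and let $G\subseteq K_{m,n}$ be a bipartite graph without isolated vertices, with left vertices $1,\dots,m$ and right vertices $\bar 1,\dots,\bar n$. For $1\le i\le m$ let $I_i\subseteq[n]$ be the set of $j$ such that $(i,\bar j)$ is an edge of $G$. For $I\subseteq[n]$ let $\Delta_I=\operatorname{conv}(e_j : j\in I)\subseteq\mathbb{R}^n$. For nonnegative integers $y_1,\dots,y_m$ put $$P_G(y_1,\dots,y_m)=y_1\Delta_{I_1}+\cdots+y_m\Delta_{I_m}$$ (Minkowski sum), and let $$P_G^-(y_1,\dots,y_m)=\{x\in\mathbb{R}^n : x+\Delta_{[n]}\subseteq P_G(y_1,\dots,y_m)\}$$ be the trimmed generalized permutohedron. A sequence $(a_1,\dots,a_m)$ of nonnegative integers is called $G$-draconian if $a_1+\cdots+a_m=n-1$ and $|I_{i_1}\cup\cdots\cup I_{i_k}|\ge a_{i_1}+\cdots+a_{i_k}+1$ for every nonempty subset $\{i_1<\cdots<i_k\}\subseteq[m]$. Write $(y)_0=1$ and $(y)_a=y(y+1)\cdots(y+a-1)$ for $a\ge 1$. **Theorem 4.3.** For all nonnegative integers $y_1,\dots,y_m$,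 the number of lattice points (points of $\mathbb{Z}^n$) in $P_G^-(y_1,\dots,y_m)$ is finite and equals $$\sum_{(a_1,\dots,a_m)}\ \prod_{i=1}^m\frac{(y_i)_{a_i}}{a_i!},$$ where the sum is over all $G$-draconian sequences $(a_1,\dots,a_m)$. -/

import Mathlib

open scoped Pointwise

namespace GenPermutohedron

/-- `Δ_I = conv(e_j : j ∈ I)`, the face of the standard coordinate simplex of `ℝⁿ` spanned by the
coordinate vectors with index in `I`. -/
def coordSimplex {n : ℕ} (I : Set (Fin n)) : Set (Fin n → ℝ) :=
  convexHull ℝ ((fun j => Pi.single j (1 : ℝ)) '' I)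

/-- The set `I_i ⊆ [n]` of (right) neighbours of the left vertex `i`. -/
def nbrs {m n : ℕ} (G : SimpleGraph (Fin m ⊕ Fin n)) (i : Fin m) : Set (Fin n) :=
  {j | G.Adj (Sum.inl i) (Sum.inr j)}

/-- The generalized permutohedron `P_G(y) = y_1 Δ_{I_1} + ⋯ + y_m Δ_{I_m}` (Minkowski sum of
dilated sets). -/
def genPerm {m n : ℕ} (G : SimpleGraph (Fin m ⊕ Fin n)) (y : Fin m → ℕ) : Set (Fin n → ℝ) :=
  ∑ i, (y i : ℝ) • coordSimplex (nbrs G i)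

/-- The trimmed generalized permutohedron `P_G⁻(y) = {x ∈ ℝⁿ | x + Δ_[n] ⊆ P_G(y)}`. -/
def trimmedGenPerm {m n : ℕ} (G : SimpleGraph (Fin m ⊕ Fin n)) (y : Fin m → ℕ) :
    Set (Fin n → ℝ) :=
  {x | {x} + coordSimplex (Set.univ : Set (Fin n)) ⊆ genPerm G y}

/-- The points of `P` all of whose coordinates are integers. -/
def latticePoints {n : ℕ} (P : Set (Fin n → ℝ)) : Set (Fin n → ℝ) :=
  {x | x ∈ P ∧ ∀ j, ∃ z : ℤ, x j = (z : ℝ)}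

/-- `a` is a `G`-draconian sequence: `a_1 + ⋯ + a_m = n - 1`, and
`|I_{i_1} ∪ ⋯ ∪ I_{i_k}| ≥ a_{i_1} + ⋯ + a_{i_k} + 1` for every nonempty set `{i_1 < ⋯ < i_k}` of
left vertices. -/
def IsDraconian {m n : ℕ} (G : SimpleGraph (Fin m ⊕ Fin n)) (a : Fin m → ℕ) : Prop :=
  (∑ i, a i) + 1 = n ∧
    ∀ J : Finset (Fin m), J.Nonempty → (∑ i ∈ J, a i) + 1 ≤ (⋃ i ∈ J, nbrs G i).ncard

theorem finite_draconian {m n : ℕ} (G : SimpleGraph (Fin m ⊕ Fin n)) :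
    {a : Fin m → ℕ | IsDraconian G a}.Finite := by
  refine (Set.finite_Iic (fun _ : Fin m => n)).subset fun a ha i => ?_
  have h1 : a i ≤ ∑ i, a i := Finset.single_le_sum (fun _ _ => Nat.zero_le _) (Finset.mem_univ i)
  have h2 := ha.1
  show a i ≤ n
  omega

/-- The finite set of all `G`-draconian sequences. -/
noncomputable def draconianSeqs {m n : ℕ} (G : SimpleGraph (Fin m ⊕ Fin n)) :
    Finset (Fin m → ℕ) :=
  (finite_draconian G).toFinset

end GenPermutohedron

/-! Replace each left vertex `i` of `G` by `y i` copies, and call the resulting bipartite relation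
the blow-up. Both sides of the formula count hypertrees of it, on opposite sides. Distributing each
`a i` over the `y i` copies turns a draconian sequence into hypertrees with one coordinate per copy,
and there are `(y i).multichoose (a i)` ways for each `i`. For `n ≥ 2`, the lattice points of the
trimmed polytope are the hypertrees with one coordinate per right vertex: their defining
inequalities are those of the polytope after complementing subsets of `Fin n`.

It remains to see that a hypergraph and its dual have equally many hypertrees
(`ncard_hypertrees_flip`). Fix generic edge weights and consider the spanning trees `T` that are
optimal: every nonzero circulation decreasing flow only on `T` has positive cost. Taking left
degrees minus one is a bijection from optimal trees to hypertrees. It is injective because two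
different optimal trees with equal left degrees would differ by a circulation that has positive cost
in both directions; it is surjective because the support of a cheapest flow with suitably perturbed
supplies is an optimal tree with the right degrees. Optimality is symmetric in the two sides, so the
same trees also count the hypertrees of the dual. -/

namespace GenPermutohedron

/-! ### Integer circulations, generic weights and transportation -/

section Circulations

variable {L R : Type*} [Fintype L] [Fintype R]

/-- Integer matrices supported on the bipartite relation `E` whose row and column sums vanish. -/
structure IsCirculation (E : L → R → Prop) (c : L → R → ℤ) : Prop where
  row : ∀ i, ∑ j, c i j = 0
  col : ∀ j, ∑ i, c i j = 0
  supp : ∀ i j, c i j ≠ 0 → E i j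

/-- The total cost of the matrix `c` for the edge weights `w`. -/
def cost (w c : L → R → ℤ) : ℤ := ∑ i, ∑ j, w i j * c i j

theorem cost_add (w c d : L → R → ℤ) : cost w (c + d) = cost w c + cost w d := by
  simp [cost, mul_add, Finset.sum_add_distrib]

theorem cost_neg (w c : L → R → ℤ) : cost w (-c) = -cost w c := by
  simp [cost]

theorem IsCirculation.neg {E : L → R → Prop} {c : L → R → ℤ} (hc : IsCirculation E c) :
    IsCirculation E (-c) where
  row i := by simp [hc.row i]
  col j := by simp [hc.col j]
  supp i j h := hc.supp i j (by simpa using h)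

/-- Weights that give nonzero cost to every nonzero matrix with entries in `{-1, 0, 1}`. -/
def GenericWeight (w : L → R → ℤ) : Prop :=
  ∀ c : L → R → ℤ, (∀ i j, |c i j| ≤ 1) → c ≠ 0 → cost w c ≠ 0

/-- Distinct powers of two work: zero cost would equate the binary expansions indexed by the entries
`1` and by the entries `-1`, forcing the two index sets to coincide. -/
theorem exists_genericWeight : ∃ w : L → R → ℤ, GenericWeight w := by
  classical
  let e : L × R ↪ ℕ := (Fintype.equivFin (L × R)).toEmbedding.trans Fin.valEmbedding
  refine ⟨fun i j => ((2 ^ e (i, j) : ℕ) : ℤ), fun c hc h0 h => h0 ?_⟩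
  let P : Finset (L × R) := Finset.univ.filter fun p => c p.1 p.2 = 1
  let N : Finset (L × R) := Finset.univ.filter fun p => c p.1 p.2 = -1
  have hcases : ∀ i j, c i j = 0 ∨ c i j = 1 ∨ c i j = -1 := fun i j => by
    have := abs_le.1 (hc i j)
    omega
  have hsum : (∑ p ∈ P, 2 ^ e p : ℕ) = ∑ p ∈ N, 2 ^ e p := by
    have h1 : cost (fun i j => ((2 ^ e (i, j) : ℕ) : ℤ)) c =
        ((∑ p ∈ P, 2 ^ e p : ℕ) : ℤ) - ((∑ p ∈ N, 2 ^ e p : ℕ) : ℤ) := by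
      rw [cost, ← Fintype.sum_prod_type' (f := fun i j => ((2 ^ e (i, j) : ℕ) : ℤ) * c i j)]
      simp only [P, N, Finset.sum_filter]
      push_cast
      rw [← Finset.sum_sub_distrib]
      refine Finset.sum_congr rfl fun p _ => ?_
      rcases hcases p.1 p.2 with h | h | h <;> simp [h]
    omega
  have hPN : P.map e = N.map e := by
    apply Finset.geomSum_injective (n := 2) le_rfl
    simpa using hsum
  have hPN' : P = N := Finset.map_injective e hPN
  funext i j
  rcases hcases i j with h | h | h
  · exact h
  · have : (i, j) ∈ P := by simp [P, h]
    rw [hPN'] at this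
    simp [N, h] at this
  · have : (i, j) ∈ N := by simp [N, h]
    rw [← hPN'] at this
    simp [P, h] at this

/-- Every nonzero circulation dominates, sign by sign, a nonzero one with entries `-1, 0, 1`. -/
theorem IsCirculation.exists_conformal {E : L → R → Prop} {c : L → R → ℤ}
    (hc : IsCirculation E c) (h0 : c ≠ 0) :
    ∃ z : L → R → ℤ, IsCirculation E z ∧ z ≠ 0 ∧ (∀ i j, |z i j| ≤ 1) ∧
      (∀ i j, 0 < z i j → 0 < c i j) ∧ (∀ i j, z i j < 0 → c i j < 0) := by
  classical
  have hrow : ∀ i, (∃ j, c i j < 0) → ∃ j, 0 < c i j := by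
    rintro i ⟨j, hj⟩
    by_contra! h
    exact (Finset.sum_neg' (fun j _ => h j) ⟨j, Finset.mem_univ j, hj⟩).ne (hc.row i)
  have hcol : ∀ j, (∃ i, 0 < c i j) → ∃ i, c i j < 0 := by
    rintro j ⟨i, hi⟩
    by_contra! h
    exact (Finset.sum_pos' (fun i _ => h i) ⟨i, Finset.mem_univ i, hi⟩).ne' (hc.col j)
  let D := {j // ∃ i, c i j < 0}
  have hD : Nonempty D := by
    by_contra hne
    refine h0 (funext fun i => funext fun j => ?_)
    rcases lt_trichotomy (c i j) 0 with h | h | h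
    · exact (hne ⟨j, i, h⟩).elim
    · exact h
    · exact (hne ⟨j, hcol j ⟨i, h⟩⟩).elim
  choose ρ hρ using fun d : D => d.2
  have hσ : ∀ i : {i // ∃ j, c i j < 0}, ∃ d : D, 0 < c i d := fun i => by
    obtain ⟨j, hj⟩ := hrow i i.2
    exact ⟨⟨j, hcol j ⟨i, hj⟩⟩, hj⟩
  choose σ hσ using hσ
  let ρ' : D → {i // ∃ j, c i j < 0} := fun d => ⟨ρ d, d, hρ d⟩
  -- From a column, go to a row where `c` is negative, then to a column where `c` is positive in
  -- that row; vanishing column sums let the walk continue. Finiteness gives periodic columns, on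
  -- which `g` is a bijection.
  let g : D → D := fun d => σ (ρ' d)
  have hg : ∀ d, 0 < c (ρ d) (g d) := fun d => hσ (ρ' d)
  let C : Finset D := Finset.univ.filter (· ∈ Function.periodicPts g)
  have hbij : Set.BijOn g C C := by
    have := Function.bijOn_periodicPts g
    simpa [C] using this
  have hCne : C.Nonempty := by
    obtain ⟨d⟩ := hD
    obtain ⟨a, b, hab, h⟩ := Finite.exists_ne_map_eq_of_infinite (fun k : ℕ => g^[k] d)
    wlog hlt : a < b generalizing a b
    · exact this b a hab.symm h.symm (by omega)
    refine ⟨g^[a] d, ?_⟩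
    simp only [C, Finset.mem_filter, Finset.mem_univ, true_and]
    refine Function.mk_mem_periodicPts (n := b - a) (by omega) ?_
    show g^[b - a] (g^[a] d) = g^[a] d
    rw [← Function.iterate_add_apply, Nat.sub_add_cancel hlt.le]
    exact h.symm
  have hρinj : ∀ d ∈ C, ∀ d' ∈ C, ρ d = ρ d' → d = d' := fun d hd d' hd' h =>
    hbij.injOn hd hd' (congrArg σ (Subtype.ext h))
  let p : L → R → Finset D := fun i j => C.filter fun d : D => ρ d = i ∧ (g d : R) = j
  let q : L → R → Finset D := fun i j => C.filter fun d : D => ρ d = i ∧ (d : R) = j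
  have hp1 : ∀ i j, (p i j).card ≤ 1 := fun i j => Finset.card_le_one.2 fun d hd d' hd' => by
    simp only [p, Finset.mem_filter] at hd hd'
    exact hρinj d hd.1 d' hd'.1 (hd.2.1.trans hd'.2.1.symm)
  have hq1 : ∀ i j, (q i j).card ≤ 1 := fun i j => Finset.card_le_one.2 fun d hd d' hd' => by
    simp only [q, Finset.mem_filter] at hd hd'
    exact hρinj d hd.1 d' hd'.1 (hd.2.1.trans hd'.2.1.symm)
  have hpc : ∀ i j, 0 < (p i j).card → 0 < c i j := fun i j h => by
    obtain ⟨d, hd⟩ := Finset.card_pos.1 h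
    simp only [p, Finset.mem_filter] at hd
    have := hg d
    rwa [hd.2.1, hd.2.2] at this
  have hqc : ∀ i j, 0 < (q i j).card → c i j < 0 := fun i j h => by
    obtain ⟨d, hd⟩ := Finset.card_pos.1 h
    simp only [q, Finset.mem_filter] at hd
    have := hρ d
    rwa [hd.2.1, hd.2.2] at this
  -- The circulation along the cycles of `g`: `+1` at `(ρ d, g d)` and `-1` at `(ρ d, d)`. Rows
  -- cancel term by term, columns because `g` permutes `C`.
  refine ⟨fun i j => (p i j).card - (q i j).card, ⟨fun i => ?_, fun j => ?_, fun i j h => ?_⟩,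
    ?_, fun i j => ?_, fun i j h => hpc i j ?_, fun i j h => hqc i j ?_⟩
  · have h1 : ∑ j, ((p i j).card : ℤ) = (C.filter fun d : D => ρ d = i).card := by
      rw [Finset.card_eq_sum_card_fiberwise (f := fun d : D => (g d : R)) (t := Finset.univ)
        (fun _ _ => Finset.mem_univ _)]
      simp [p, Finset.filter_filter]
    have h2 : ∑ j, ((q i j).card : ℤ) = (C.filter fun d : D => ρ d = i).card := by
      rw [Finset.card_eq_sum_card_fiberwise (f := fun d : D => (d : R)) (t := Finset.univ)
        (fun _ _ => Finset.mem_univ _)]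
      simp [q, Finset.filter_filter]
    rw [Finset.sum_sub_distrib, h1, h2, sub_self]
  · have h1 : ∑ i, ((p i j).card : ℤ) = (C.filter fun d : D => (g d : R) = j).card := by
      rw [Finset.card_eq_sum_card_fiberwise (f := ρ) (t := Finset.univ)
        (fun _ _ => Finset.mem_univ _)]
      simp [p, Finset.filter_filter, and_comm]
    have h2 : ∑ i, ((q i j).card : ℤ) = (C.filter fun d : D => (d : R) = j).card := by
      rw [Finset.card_eq_sum_card_fiberwise (f := ρ) (t := Finset.univ)
        (fun _ _ => Finset.mem_univ _)]
      simp [q, Finset.filter_filter, and_comm]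
    have h3 : (C.filter fun d : D => (g d : R) = j).card = (C.filter fun d : D => (d : R) = j).card := by
      refine Finset.card_nbij g (fun d hd => ?_) (fun d hd d' hd' h => ?_) (fun d hd => ?_)
      · simp only [Finset.coe_filter, Set.mem_ofPred_eq] at hd ⊢
        exact ⟨hbij.mapsTo hd.1, hd.2⟩
      · simp only [Finset.coe_filter, Set.mem_ofPred_eq] at hd hd'
        exact hbij.injOn hd.1 hd'.1 h
      · simp only [Finset.coe_filter, Set.mem_ofPred_eq] at hd
        obtain ⟨d', hd', rfl⟩ := hbij.surjOn hd.1
        exact ⟨d', by simpa using ⟨hd', hd.2⟩, rfl⟩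
    rw [Finset.sum_sub_distrib, h1, h2, h3, sub_self]
  · refine hc.supp i j fun h' => h ?_
    have := hpc i j
    have := hqc i j
    omega
  · obtain ⟨d, hd⟩ := hCne
    intro h
    have h1 : ((p (ρ d) d).card : ℤ) - (q (ρ d) d).card = 0 := congrFun (congrFun h (ρ d)) d
    have h2 : 0 < (q (ρ d) d).card := Finset.card_pos.2 ⟨d, by simp [q, hd]⟩
    have := hpc (ρ d) d
    have := hqc (ρ d) d
    omega
  · have := hp1 i j
    have := hq1 i j
    rw [abs_le]
    dsimp only
    omega
  · dsimp only at h
    omega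
  · dsimp only at h
    omega

/-- To check that the circulations whose negative part lies in `T` have positive cost, it is
enough to look at those with entries `-1, 0, 1`. -/
theorem cost_pos_of_unit {E : L → R → Prop} {w : L → R → ℤ} {T : Set (L × R)}
    (H : ∀ z, IsCirculation E z → (∀ i j, |z i j| ≤ 1) → (∀ i j, z i j < 0 → (i, j) ∈ T) →
      z ≠ 0 → 0 < cost w z)
    {c : L → R → ℤ} (hc : IsCirculation E c) (hT : ∀ i j, c i j < 0 → (i, j) ∈ T) (h0 : c ≠ 0) :
    0 < cost w c := by
  induction hN : ∑ i, ∑ j, (c i j).natAbs using Nat.strong_induction_on generalizing c with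
  | _ N ih =>
    obtain ⟨z, hz, hz0, hz1, hzp, hzn⟩ := hc.exists_conformal h0
    have hzcost : 0 < cost w z := H z hz hz1 (fun i j h => hT i j (hzn i j h)) hz0
    -- Conformality makes subtracting `z` lower the sum of absolute values without creating new
    -- negative entries or new support.
    have key : ∀ i j, (c i j - z i j).natAbs + (z i j).natAbs = (c i j).natAbs ∧
        (c i j - z i j < 0 → c i j < 0) ∧ (c i j - z i j ≠ 0 → c i j ≠ 0) := fun i j => by
      have h1 := abs_le.1 (hz1 i j)
      have h2 := hzp i j
      have h3 := hzn i j
      omega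
    by_cases hcz : c - z = 0
    · rwa [sub_eq_zero.1 hcz]
    have hcirc : IsCirculation E (c - z) :=
      ⟨fun i => by simp [hc.row i, hz.row i], fun j => by simp [hc.col j, hz.col j],
        fun i j h => hc.supp i j ((key i j).2.2 h)⟩
    have hlt : ∑ i, ∑ j, ((c - z) i j).natAbs < N := by
      have hsum : ∑ i, ∑ j, ((c - z) i j).natAbs + ∑ i, ∑ j, (z i j).natAbs = N := by
        rw [← hN]
        simp only [← Finset.sum_add_distrib]
        exact Finset.sum_congr rfl fun i _ => Finset.sum_congr rfl fun j _ => (key i j).1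
      have hpos : 0 < ∑ i, ∑ j, (z i j).natAbs := by
        by_contra! h
        refine hz0 (funext fun i => funext fun j => ?_)
        have h1 := Nat.le_zero.1 h
        simp only [Finset.sum_eq_zero_iff, Finset.mem_univ, true_implies] at h1
        exact Int.natAbs_eq_zero.1 (h1 i j)
      omega
    have := ih _ hlt hcirc (fun i j h => hT i j ((key i j).2.1 h)) hcz rfl
    have h2 := cost_add w (c - z) z
    rw [sub_add_cancel] at h2
    omega

open Classical in
/-- Integral transportation theorem: Hall's condition gives a matrix of natural numbers supported
on `E` with prescribed row and column sums. -/
theorem exists_transport (E : L → R → Prop) (r : L → ℕ) (s : R → ℕ)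
    (hrs : ∑ i, r i = ∑ j, s j)
    (hall : ∀ J : Finset L, ∑ i ∈ J, r i ≤ ∑ j with ∃ i ∈ J, E i j, s j) :
    ∃ b : L → R → ℕ, (∀ i, ∑ j, b i j = r i) ∧ (∀ j, ∑ i, b i j = s j) ∧
      ∀ i j, b i j ≠ 0 → E i j := by
  -- Split supplies and demands into units and apply Hall's marriage theorem; equal totals make the
  -- matching bijective, and `b i j` counts the units of `i` matched to `j`.
  let t : (Σ i, Fin (r i)) → Finset (Σ j, Fin (s j)) := fun x =>
    Finset.univ.filter fun y => E x.1 y.1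
  have hH : ∀ A : Finset (Σ i, Fin (r i)), A.card ≤ (A.biUnion t).card := fun A => by
    let J := A.image Sigma.fst
    calc A.card ≤ (J.sigma fun i => (Finset.univ : Finset (Fin (r i)))).card :=
          Finset.card_le_card fun x hx => by simpa [J] using ⟨x.2, hx⟩
      _ = ∑ i ∈ J, r i := by simp
      _ ≤ ∑ j with ∃ i ∈ J, E i j, s j := hall J
      _ = ((Finset.univ.filter fun j => ∃ i ∈ J, E i j).sigma
            fun j => (Finset.univ : Finset (Fin (s j)))).card := by simp
      _ ≤ (A.biUnion t).card := Finset.card_le_card fun y hy => by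
          simp only [Finset.mem_sigma, Finset.mem_filter, Finset.mem_univ, true_and,
            and_true] at hy
          obtain ⟨i, hi, hE⟩ := hy
          obtain ⟨x, hx, rfl⟩ := Finset.mem_image.1 hi
          exact Finset.mem_biUnion.2 ⟨x, hx, by simpa [t] using hE⟩
  obtain ⟨f, hf, hft⟩ := (Finset.all_card_le_biUnion_card_iff_exists_injective t).1 hH
  have hfb : Function.Bijective f :=
    (Fintype.bijective_iff_injective_and_card f).2 ⟨hf, by simp [hrs]⟩
  refine ⟨fun i j => (Finset.univ.filter fun k : Fin (r i) => (f ⟨i, k⟩).1 = j).card,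
    fun i => ?_, fun j => ?_, fun i j h => ?_⟩
  · have := Finset.card_eq_sum_card_fiberwise (f := fun k : Fin (r i) => (f ⟨i, k⟩).1)
      (s := Finset.univ) (t := Finset.univ) (fun _ _ => Finset.mem_univ _)
    simpa using this.symm
  · have h1 : ∑ i, (Finset.univ.filter fun k : Fin (r i) => (f ⟨i, k⟩).1 = j).card =
        (Finset.univ.filter fun x => (f x).1 = j).card := by
      rw [← Finset.card_sigma]
      congr 1
      ext x
      simp
    have h2 : (Finset.univ.filter fun x => (f x).1 = j).card =
        (Finset.univ.filter fun y : Σ j, Fin (s j) => y.1 = j).card :=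
      Finset.card_nbij f (fun x hx => by simpa using hx) hf.injOn fun y hy => by
        obtain ⟨x, rfl⟩ := hfb.2 y
        exact ⟨x, by simpa using hy, rfl⟩
    have h3 : (Finset.univ.filter fun y : Σ j, Fin (s j) => y.1 = j) =
        (Finset.univ : Finset (Fin (s j))).map ⟨Sigma.mk j, sigma_mk_injective⟩ := by
      ext ⟨j', k⟩
      constructor
      · intro h
        obtain rfl : j' = j := by simpa using h
        simp
      · intro h
        obtain ⟨k', -, hk⟩ := Finset.mem_map.1 h
        have : j = j' := congrArg Sigma.fst hk
        simp [this]
    rw [h1, h2, h3, Finset.card_map, Finset.card_univ, Fintype.card_fin]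
  · obtain ⟨k, hk⟩ := Finset.card_pos.1 (Nat.pos_of_ne_zero h)
    have h1 := hft ⟨i, k⟩
    simp only [t, Finset.mem_filter, Finset.mem_univ, true_and] at h1 hk
    rwa [hk] at h1

end Circulations

/-! ### Optimal trees and the duality of hypertrees -/

section Duality

variable {L R : Type*} [Fintype L] [Fintype R]

/-- `T` is a set of edges of `E` such that rerouting along `E`, decreasing the flow only on `T`,
always increases the cost. -/
structure IsOptimal (w : L → R → ℤ) (E : L → R → Prop) (T : Finset (L × R)) : Prop where
  subset : ∀ p ∈ T, E p.1 p.2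
  cost_pos : ∀ c, IsCirculation E c → (∀ i j, c i j < 0 → (i, j) ∈ T) → c ≠ 0 → 0 < cost w c

/-- The edge sets of optimal trees. -/
def optimalTrees (w : L → R → ℤ) (E : L → R → Prop) : Set (Finset (L × R)) :=
  {T | IsOptimal w E T ∧ T.card + 1 = Fintype.card L + Fintype.card R}

open Classical in
/-- The hypertrees of the hypergraph on `R` with hyperedges `{j | E i j}`, `i : L`. -/
def hypertrees (E : L → R → Prop) : Set (L → ℕ) :=
  {a | ∑ i, a i + 1 = Fintype.card R ∧ ∀ J : Finset L, J.Nonempty →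
    ∑ i ∈ J, a i + 1 ≤ (Finset.univ.filter fun j => ∃ i ∈ J, E i j).card}

open Classical in
/-- An optimal edge set spans forests. -/
theorem IsOptimal.card_le {w : L → R → ℤ} {E : L → R → Prop} {T : Finset (L × R)}
    (hT : IsOptimal w E T) (A : Finset L) (hA : A.Nonempty) (B : Finset R) :
    (T.filter fun p => p.1 ∈ A ∧ p.2 ∈ B).card + 1 ≤ A.card + B.card := by
  rcases B.eq_empty_or_nonempty with rfl | ⟨j₀, hj₀⟩
  · simpa using hA.card_pos
  set F := T.filter fun p => p.1 ∈ A ∧ p.2 ∈ B with hF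
  let ext : (F → ℤ) →ₗ[ℤ] (L → R → ℤ) :=
    { toFun := fun x i j => if h : (i, j) ∈ F then x ⟨(i, j), h⟩ else 0
      map_add' := fun x y => by
        funext i j
        by_cases h : (i, j) ∈ F <;> simp [h]
      map_smul' := fun k x => by
        funext i j
        by_cases h : (i, j) ∈ F <;> simp [h] }
  have hext : ∀ x i j, ext x i j ≠ 0 → (i, j) ∈ F := fun x i j h => by
    by_contra h'
    exact h (by simp [ext, h'])
  -- Row and column sums, omitting the column `j₀`, whose sum is determined by the others. The
  -- target then has rank `|A| + |B| - 1`.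
  let φ : (F → ℤ) →ₗ[ℤ] (A → ℤ) × (B.erase j₀ → ℤ) :=
    { toFun := fun x => (fun i => ∑ j, ext x i j, fun j => ∑ i, ext x i j)
      map_add' := fun x y => by
        rw [map_add]
        ext <;> simp [Finset.sum_add_distrib]
      map_smul' := fun k x => by
        rw [map_smul]
        ext <;> simp [Finset.mul_sum] }
  have hφ : Function.Injective φ := by
    refine (injective_iff_map_eq_zero φ).2 fun x hx => ?_
    have hrow : ∀ i, ∑ j, ext x i j = 0 := fun i => by
      by_cases hi : i ∈ A
      · exact congrFun (congrArg Prod.fst hx) ⟨i, hi⟩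
      · refine Finset.sum_eq_zero fun j _ => ?_
        by_contra h
        exact hi (Finset.mem_filter.1 (hext x i j h)).2.1
    have hcol' : ∀ j, j ≠ j₀ → ∑ i, ext x i j = 0 := fun j hj => by
      by_cases hjB : j ∈ B
      · exact congrFun (congrArg Prod.snd hx) ⟨j, Finset.mem_erase.2 ⟨hj, hjB⟩⟩
      · refine Finset.sum_eq_zero fun i _ => ?_
        by_contra h
        exact hjB (Finset.mem_filter.1 (hext x i j h)).2.2
    have hcol : ∀ j, ∑ i, ext x i j = 0 := fun j => by
      by_cases hj : j = j₀
      · have h1 : ∑ j, ∑ i, ext x i j = 0 := by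
          rw [Finset.sum_comm]
          exact Finset.sum_eq_zero fun i _ => hrow i
        rw [Fintype.sum_eq_single j₀ hcol'] at h1
        rw [hj, h1]
      · exact hcol' j hj
    have hc : IsCirculation E (ext x) :=
      ⟨hrow, hcol, fun i j h => hT.subset _ (Finset.mem_filter.1 (hext x i j h)).1⟩
    -- A circulation supported on `T` and its negative both decrease flow only on `T`, so if nonzero
    -- both would have positive cost.
    have h0 : ext x = 0 := by
      by_contra h
      have h1 := hT.cost_pos _ hc (fun i j hij => (Finset.mem_filter.1 (hext x i j hij.ne)).1) h
      have h2 := hT.cost_pos _ hc.neg (fun i j hij =>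
        (Finset.mem_filter.1 (hext x i j fun h => by simp [h] at hij)).1) (neg_ne_zero.2 h)
      rw [cost_neg] at h2
      omega
    funext p
    have := congrFun (congrFun h0 p.1.1) p.1.2
    simpa [ext] using this
  have := LinearMap.finrank_le_finrank_of_injective hφ
  rw [Module.finrank_prod, Module.finrank_fintype_fun_eq_card, Module.finrank_fintype_fun_eq_card,
    Module.finrank_fintype_fun_eq_card, Fintype.card_coe, Fintype.card_coe, Fintype.card_coe,
    Finset.card_erase_of_mem hj₀] at this
  have := Finset.card_pos.2 ⟨j₀, hj₀⟩
  omega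

open Classical in
/-- The degree of the left vertex `i` in the edge set `T`. -/
noncomputable def leftDeg (T : Finset (L × R)) (i : L) : ℕ := (T.filter fun p => p.1 = i).card

open Classical in
theorem sum_leftDeg {L R : Type*} (T : Finset (L × R)) (J : Finset L) :
    ∑ i ∈ J, leftDeg T i = (T.filter fun p => p.1 ∈ J).card := by
  rw [Finset.card_eq_sum_card_fiberwise (s := T.filter fun p => p.1 ∈ J) (f := Prod.fst) (t := J)
    (fun p hp => (Finset.mem_filter.1 hp).2)]
  refine Finset.sum_congr rfl fun i hi => ?_
  rw [leftDeg, Finset.filter_filter]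
  congr 1
  refine Finset.filter_congr fun p _ => ?_
  constructor
  · rintro rfl
    exact ⟨hi, rfl⟩
  · exact fun h => h.2

theorem sum_univ_leftDeg {L R : Type*} [Fintype L] (T : Finset (L × R)) : ∑ i, leftDeg T i = T.card := by
  classical
  rw [sum_leftDeg]
  simp

open Classical in
theorem IsOptimal.sum_leftDeg_lt {w : L → R → ℤ} {E : L → R → Prop} {T : Finset (L × R)}
    (hT : IsOptimal w E T) (J : Finset L) (hJ : J.Nonempty) (B : Finset R)
    (hB : ∀ p ∈ T, p.1 ∈ J → p.2 ∈ B) :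
    ∑ i ∈ J, leftDeg T i + 1 ≤ J.card + B.card := by
  rw [sum_leftDeg]
  convert hT.card_le J hJ B using 3
  refine Finset.filter_congr fun p hp => ?_
  exact ⟨fun h => ⟨h, hB p hp h⟩, fun h => h.1⟩

/-- If `i` were isolated, all `|L| + |R| - 1` edges would lie on the remaining vertices, exceeding
the forest bound. -/
theorem leftDeg_pos {w : L → R → ℤ} {E : L → R → Prop} {T : Finset (L × R)}
    (hT : T ∈ optimalTrees w E) (hR : 0 < Fintype.card R) (i : L) : 0 < leftDeg T i := by
  classical
  have hsum := Finset.add_sum_erase Finset.univ (leftDeg T) (Finset.mem_univ i)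
  rw [sum_univ_leftDeg] at hsum
  have h2 := hT.2
  have hc := Finset.card_erase_of_mem (Finset.mem_univ i)
  rw [Finset.card_univ] at hc
  rcases (Finset.univ.erase i).eq_empty_or_nonempty with h | h
  · rw [h, Finset.sum_empty] at hsum
    have : 0 < Fintype.card L := Fintype.card_pos_iff.2 ⟨i⟩
    omega
  · have := hT.1.sum_leftDeg_lt _ h Finset.univ (fun _ _ _ => Finset.mem_univ _)
    rw [Finset.card_univ] at this
    have : 0 < Fintype.card L := Fintype.card_pos_iff.2 ⟨i⟩
    omega

theorem leftDeg_sub_one_mem_hypertrees {w : L → R → ℤ} {E : L → R → Prop} {T : Finset (L × R)}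
    (hT : T ∈ optimalTrees w E) (hR : 0 < Fintype.card R) :
    (fun i => leftDeg T i - 1) ∈ hypertrees E := by
  classical
  have key : ∀ J : Finset L, ∑ i ∈ J, (leftDeg T i - 1) + J.card = ∑ i ∈ J, leftDeg T i :=
    fun J => by
      rw [Finset.card_eq_sum_ones, ← Finset.sum_add_distrib]
      refine Finset.sum_congr rfl fun i _ => ?_
      have := leftDeg_pos hT hR i
      omega
  refine ⟨?_, fun J hJ => ?_⟩
  · have h1 := key Finset.univ
    have h2 := hT.2
    rw [sum_univ_leftDeg, Finset.card_univ] at h1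
    dsimp only
    omega
  · have h1 := key J
    have h2 := hT.1.sum_leftDeg_lt J hJ (Finset.univ.filter fun j => ∃ i ∈ J, E i j)
      (fun p hp hpJ => by simpa using ⟨p.1, hpJ, hT.1.subset p hp⟩)
    dsimp only
    omega

/-- The step relation of the digraph with the edges of `T` directed from left to right and those
of `T'` directed from right to left. -/
inductive AltStep (T T' : Finset (L × R)) : L ⊕ R → L ⊕ R → Prop
  | fwd {i : L} {j : R} : (i, j) ∈ T → AltStep T T' (Sum.inl i) (Sum.inr j)
  | bwd {i : L} {j : R} : (i, j) ∈ T' → AltStep T T' (Sum.inr j) (Sum.inl i)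

open Classical in
/-- The flow along a path of the alternating digraph. -/
theorem exists_flow_of_reachable {T T' : Finset (L × R)} {x y : L ⊕ R}
    (h : Relation.ReflTransGen (AltStep T T') x y) :
    ∃ c : L → R → ℤ, (∀ i j, c i j < 0 → (i, j) ∈ T) ∧ (∀ i j, 0 < c i j → (i, j) ∈ T') ∧
      (∀ i, ∑ j, c i j = (if y = Sum.inl i then 1 else 0) - (if x = Sum.inl i then 1 else 0)) ∧
      (∀ j, ∑ i, c i j =
        (if x = Sum.inr j then 1 else 0) - (if y = Sum.inr j then 1 else 0)) := by
  induction h with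
  | refl => exact ⟨0, by simp, by simp, by simp, by simp⟩
  | tail _ hyz ih =>
    obtain ⟨c, h1, h2, h3, h4⟩ := ih
    cases hyz with
    | @fwd i j hij =>
      refine ⟨fun i' j' => c i' j' - if i' = i ∧ j' = j then 1 else 0, fun i' j' h => ?_,
        fun i' j' h => ?_, fun i' => ?_, fun j' => ?_⟩
      · by_cases hh : i' = i ∧ j' = j
        · rw [hh.1, hh.2]
          exact hij
        · exact h1 i' j' (by simpa [hh] using h)
      · refine h2 i' j' (lt_of_lt_of_le h ?_)
        dsimp only
        split_ifs <;> omega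
      · rw [Finset.sum_sub_distrib, h3]
        by_cases hh : i' = i
        · subst hh; simp
        · simp [hh, Ne.symm hh]
      · rw [Finset.sum_sub_distrib, h4]
        by_cases hh : j' = j
        · subst hh; simp
        · simp [hh, Ne.symm hh]
    | @bwd i j hij =>
      refine ⟨fun i' j' => c i' j' + if i' = i ∧ j' = j then 1 else 0, fun i' j' h => ?_,
        fun i' j' h => ?_, fun i' => ?_, fun j' => ?_⟩
      · refine h1 i' j' (lt_of_le_of_lt ?_ h)
        dsimp only
        split_ifs <;> omega
      · by_cases hh : i' = i ∧ j' = j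
        · rw [hh.1, hh.2]
          exact hij
        · exact h2 i' j' (by simpa [hh] using h)
      · rw [Finset.sum_add_distrib, h3]
        by_cases hh : i' = i
        · subst hh; simp; ring
        · simp [hh, Ne.symm hh]
      · rw [Finset.sum_add_distrib, h4]
        by_cases hh : j' = j
        · subst hh; simp
        · simp [hh, Ne.symm hh]

/-- For optimal trees with equal left degrees the alternating digraph connects every right vertex
to every left vertex. -/
theorem reachable_of_leftDeg_eq {w : L → R → ℤ} {E : L → R → Prop} {T T' : Finset (L × R)}
    (hT : T ∈ optimalTrees w E) (hT' : T' ∈ optimalTrees w E)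
    (hdeg : leftDeg T = leftDeg T') {j₀ : R} (i : L)
    (hj₀ : ∃ i, (i, j₀) ∈ T') :
    Relation.ReflTransGen (AltStep T T') (Sum.inr j₀) (Sum.inl i) := by
  classical
  let A : Finset L := Finset.univ.filter fun i =>
    Relation.ReflTransGen (AltStep T T') (Sum.inr j₀) (Sum.inl i)
  let B : Finset R := Finset.univ.filter fun j =>
    Relation.ReflTransGen (AltStep T T') (Sum.inr j₀) (Sum.inr j)
  have hA : A.Nonempty := by
    obtain ⟨i, hi⟩ := hj₀
    exact ⟨i, by simpa [A] using Relation.ReflTransGen.single (AltStep.bwd hi)⟩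
  have hfwd : ∀ p ∈ T, p.1 ∈ A → p.2 ∈ B := fun p hp hpA => by
    simp only [A, B, Finset.mem_filter, Finset.mem_univ, true_and] at hpA ⊢
    exact hpA.tail (AltStep.fwd hp)
  have hbwd : ∀ p ∈ T', p.1 ∈ Aᶜ → p.2 ∈ Bᶜ := fun p hp hpA => by
    simp only [A, B, Finset.mem_filter, Finset.mem_univ, true_and, Finset.mem_compl] at hpA ⊢
    exact fun h => hpA (h.tail (AltStep.bwd hp))
  -- If some left vertex is unreachable, the forest bounds for `T` on `A, B` and for `T'` on the
  -- complements add up, by equality of degrees, to at most `|L| + |R| - 2` edges.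
  have h1 := hT.1.sum_leftDeg_lt A hA B hfwd
  rcases Aᶜ.eq_empty_or_nonempty with h | h
  · have : i ∈ A := by
      rw [Finset.compl_eq_empty_iff] at h
      rw [h]
      exact Finset.mem_univ i
    simpa [A] using this
  · have h2 := hT'.1.sum_leftDeg_lt Aᶜ h Bᶜ hbwd
    rw [← hdeg] at h2
    have h3 := Finset.sum_add_sum_compl A (leftDeg T)
    rw [sum_univ_leftDeg] at h3
    have h4 := A.card_add_card_compl
    have h5 := B.card_add_card_compl
    have h6 := hT.2
    omega

/-- An edge of `T` outside `T'` closes up, through an alternating path, to a nonzero circulation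
negative only on `T` and positive only on `T'`. Optimality of both trees gives it and its negative
positive cost. -/
theorem leftDeg_sub_one_injOn (w : L → R → ℤ) (E : L → R → Prop) (hR : 0 < Fintype.card R) :
    Set.InjOn (fun T i => leftDeg T i - 1) (optimalTrees w E) := by
  classical
  intro T hT T' hT' h
  have hdeg : leftDeg T = leftDeg T' := funext fun i => by
    have h1 := congrFun h i
    have h2 := leftDeg_pos hT hR i
    have h3 := leftDeg_pos hT' hR i
    dsimp only at h1
    omega
  refine Finset.eq_of_subset_of_card_le (fun p hp => ?_) ?_
  · by_contra hp'
    have hcard : T'.card + 1 = Fintype.card L + Fintype.card R := hT'.2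
    -- Otherwise `T'` would have too many edges for a forest avoiding the right vertex `p.2`.
    have hj : ∃ i, (i, p.2) ∈ T' := by
      by_contra! hj
      have h1 := hT'.1.card_le Finset.univ ⟨p.1, Finset.mem_univ _⟩ (Finset.univ.erase p.2)
      rw [Finset.filter_true_of_mem, Finset.card_erase_of_mem (Finset.mem_univ _),
        Finset.card_univ, Finset.card_univ] at h1
      · omega
      · rintro ⟨i, j⟩ hq
        simp only [Finset.mem_univ, Finset.mem_erase, and_true, true_and]
        rintro rfl
        exact hj i hq
    obtain ⟨c, h1, h2, h3, h4⟩ := exists_flow_of_reachable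
      (reachable_of_leftDeg_eq hT hT' hdeg p.1 hj)
    let c' : L → R → ℤ := fun i j => c i j - if i = p.1 ∧ j = p.2 then 1 else 0
    have hneg : ∀ i j, c' i j < 0 → (i, j) ∈ T := fun i j h => by
      by_cases hh : i = p.1 ∧ j = p.2
      · rw [hh.1, hh.2]
        exact hp
      · exact h1 i j (by simpa [c', hh] using h)
    have hpos : ∀ i j, 0 < c' i j → (i, j) ∈ T' := fun i j h => by
      refine h2 i j (lt_of_lt_of_le h ?_)
      dsimp only [c']
      split_ifs <;> omega
    have hc : IsCirculation E c' := by
      refine ⟨fun i => ?_, fun j => ?_, fun i j hij => ?_⟩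
      · dsimp only [c']
        rw [Finset.sum_sub_distrib, h3]
        by_cases hh : i = p.1
        · subst hh; simp
        · simp [hh, Ne.symm hh]
      · dsimp only [c']
        rw [Finset.sum_sub_distrib, h4]
        by_cases hh : j = p.2
        · subst hh; simp
        · simp [hh, Ne.symm hh]
      · rcases lt_or_gt_of_ne hij with h | h
        · exact hT.1.subset _ (hneg i j h)
        · exact hT'.1.subset _ (hpos i j h)
    have h0 : c' ≠ 0 := fun h => by
      have h5 : c p.1 p.2 - (if p.1 = p.1 ∧ p.2 = p.2 then 1 else 0) = 0 :=
        congrFun (congrFun h p.1) p.2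
      simp only [and_self, if_true] at h5
      exact hp' (h2 p.1 p.2 (by omega))
    have h5 := hT.1.cost_pos c' hc hneg h0
    have h6 := hT'.1.cost_pos (-c') hc.neg (fun i j h => hpos i j (by simpa using h))
      (neg_ne_zero.2 h0)
    rw [cost_neg] at h6
    omega
  · have h1 := hT.2
    have h2 := hT'.2
    omega

/-- The tree is the support of a cheapest flow whose supplies slightly exceed multiples of the
demand, which forces enough edges at each left vertex. -/
theorem exists_optimalTree {w : L → R → ℤ} (hw : GenericWeight w) (E : L → R → Prop)
    {a : L → ℕ} (ha : a ∈ hypertrees E) :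
    ∃ T ∈ optimalTrees w E, (fun i => leftDeg T i - 1) = a := by
  classical
  rcases isEmpty_or_nonempty L with hL | hL
  · refine ⟨∅, ⟨⟨by simp, fun c _ _ h0 => (h0 (funext fun i => hL.elim i)).elim⟩, ?_⟩,
      funext fun i => hL.elim i⟩
    have := ha.1
    simp at this ⊢
    exact this
  set m := Fintype.card L with hm
  have hmpos : 0 < m := Fintype.card_pos
  -- The demand `m = |L|` is chosen so that the totals agree, `∑ (m * a i + 1) = m * (∑ a i + 1)`,
  -- and so that the extra `|J| ≤ m` in Hall's condition is absorbed by the `+ 1` in the hypertree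
  -- inequality.
  let flows : Set (L → R → ℕ) := {b | (∀ i, ∑ j, b i j = m * a i + 1) ∧ (∀ j, ∑ i, b i j = m) ∧
    ∀ i j, b i j ≠ 0 → E i j}
  have hle : ∀ b ∈ flows, ∀ i j, b i j ≤ m := fun b hb i j => by
    rw [← hb.2.1 j]
    exact Finset.single_le_sum (f := fun i => b i j) (fun _ _ => Nat.zero_le _) (Finset.mem_univ i)
  have hfin : flows.Finite := (Set.finite_Iic (fun _ _ => m : L → R → ℕ)).subset hle
  have hne : flows.Nonempty := by
    refine exists_transport E _ _ ?_ fun J => ?_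
    · rw [Finset.sum_add_distrib, ← Finset.mul_sum]
      simp only [Finset.sum_const, Finset.card_univ, smul_eq_mul, mul_one, ← ha.1]
      ring
    · rcases J.eq_empty_or_nonempty with rfl | hJ
      · simp
      · rw [Finset.sum_add_distrib, ← Finset.mul_sum]
        simp only [Finset.sum_const, smul_eq_mul, mul_one]
        have h1 := Nat.mul_le_mul_left m (ha.2 J hJ)
        have h2 : J.card ≤ m := Finset.card_le_univ J
        rw [mul_comm _ m]
        refine le_trans ?_ (h1.trans (le_of_eq ?_))
        · rw [mul_add]
          omega
        · congr!
  obtain ⟨b, hb, hmin⟩ := Set.exists_min_image flows (fun b => cost w fun i j => (b i j : ℤ))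
    hfin hne
  let T : Finset (L × R) := Finset.univ.filter fun p => b p.1 p.2 ≠ 0
  have hT : IsOptimal w E T := by
    refine ⟨fun p hp => hb.2.2 _ _ (by simpa [T] using hp), fun c hc hcT h0 => ?_⟩
    -- A unit circulation decreasing only on the support can be added to `b` keeping it nonnegative,
    -- so minimality gives cost at least zero and genericity makes it strict.
    refine cost_pos_of_unit (T := (T : Set (L × R))) (fun z hz hz1 hzT hz0 => ?_) hc
      (fun i j h => hcT i j h) h0
    have hnn : ∀ i j, 0 ≤ (b i j : ℤ) + z i j := fun i j => by
      by_cases h : z i j < 0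
      · have h1 : b i j ≠ 0 := by simpa [T] using hzT i j h
        have := abs_le.1 (hz1 i j)
        omega
      · omega
    let b' : L → R → ℕ := fun i j => ((b i j : ℤ) + z i j).toNat
    have hb' : ∀ i j, (b' i j : ℤ) = b i j + z i j := fun i j => Int.toNat_of_nonneg (hnn i j)
    have hmem : b' ∈ flows := by
      refine ⟨fun i => ?_, fun j => ?_, fun i j h => ?_⟩
      · zify
        simp only [hb', Finset.sum_add_distrib, hz.row, add_zero]
        exact_mod_cast hb.1 i
      · zify
        simp only [hb', Finset.sum_add_distrib, hz.col, add_zero]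
        exact_mod_cast hb.2.1 j
      · by_contra hE
        have h1 : b i j = 0 := by
          by_contra h1
          exact hE (hb.2.2 i j h1)
        have h2 : z i j = 0 := by
          by_contra h2
          exact hE (hz.supp i j h2)
        have := hb' i j
        omega
    have h1 := hmin b' hmem
    have h2 : cost w (fun i j => (b' i j : ℤ)) = cost w (fun i j => (b i j : ℤ)) + cost w z := by
      rw [← cost_add]
      congr 1
      funext i j
      exact hb' i j
    have h3 := hw z hz1 hz0
    omega
  -- Each edge carries at most `m`, so a supply of `m * a i + 1` needs more than `a i` edges. The
  -- forest bound on `T.card` then forces equality everywhere.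
  have hdeg : ∀ i, a i + 1 ≤ leftDeg T i := fun i => by
    have h1 : leftDeg T i = (Finset.univ.filter fun j => b i j ≠ 0).card := by
      refine Finset.card_nbij' Prod.snd (fun j => (i, j)) ?_ ?_ ?_ ?_
      · rintro ⟨i', j⟩ h
        simp only [T, Finset.coe_filter, Finset.mem_filter, Finset.mem_univ, true_and,
          Set.mem_ofPred_eq] at h ⊢
        rw [← h.2]
        exact h.1
      · intro j h
        simpa [T] using h
      · rintro ⟨i', j⟩ h
        simp only [T, Finset.coe_filter, Finset.mem_filter, Finset.mem_univ, true_and,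
          Set.mem_ofPred_eq] at h
        simp [h.2]
      · intro j _
        rfl
    have h2 : m * a i + 1 ≤ (Finset.univ.filter fun j => b i j ≠ 0).card * m := by
      rw [← hb.1 i, ← Finset.sum_filter_ne_zero, ← smul_eq_mul]
      exact Finset.sum_le_card_nsmul _ _ _ fun j _ => hle b hb i j
    rw [← h1] at h2
    by_contra! h
    have h3 := Nat.mul_le_mul_right m (Nat.lt_succ_iff.1 h)
    rw [mul_comm (a i)] at h3
    omega
  have hsum : ∑ i, (a i + 1) + 1 = m + Fintype.card R := by
    rw [Finset.sum_add_distrib, ← ha.1]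
    simp only [Finset.sum_const, Finset.card_univ, smul_eq_mul, mul_one]
    omega
  have hcard : T.card + 1 ≤ m + Fintype.card R := by
    have := hT.card_le Finset.univ Finset.univ_nonempty Finset.univ
    simpa using this
  have hle' : ∑ i, (a i + 1) ≤ ∑ i, leftDeg T i := Finset.sum_le_sum fun i _ => hdeg i
  have hTsum := sum_univ_leftDeg T
  have heq := (Finset.sum_eq_sum_iff_of_le fun i _ => hdeg i).1
    (show ∑ i, (a i + 1) = ∑ i, leftDeg T i by omega)
  refine ⟨T, ⟨hT, by omega⟩, funext fun i => ?_⟩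
  have := heq i (Finset.mem_univ i)
  omega

theorem ncard_hypertrees_eq_ncard_optimalTrees {w : L → R → ℤ} (hw : GenericWeight w)
    (E : L → R → Prop) (hR : 0 < Fintype.card R) :
    (hypertrees E).ncard = (optimalTrees w E).ncard :=
  (Set.BijOn.ncard_eq (f := fun T i => leftDeg T i - 1)
    ⟨fun _ hT => leftDeg_sub_one_mem_hypertrees hT hR, leftDeg_sub_one_injOn w E hR,
      fun _ ha => exists_optimalTree hw E ha⟩).symm

theorem cost_flip (w c : L → R → ℤ) : cost (flip w) (flip c) = cost w c := Finset.sum_comm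

theorem GenericWeight.flip {w : L → R → ℤ} (hw : GenericWeight w) : GenericWeight (flip w) :=
  fun c hc h0 => by
    rw [← cost_flip]
    exact hw _ (fun i j => hc j i) fun h => h0 (congrArg _root_.flip h)

theorem map_swap_mem_optimalTrees {w : L → R → ℤ} {E : L → R → Prop} {T : Finset (L × R)}
    (hT : T ∈ optimalTrees w E) :
    T.map (Equiv.prodComm L R).toEmbedding ∈ optimalTrees (flip w) (flip E) := by
  refine ⟨⟨fun p hp => ?_, fun c hc hcT h0 => ?_⟩, ?_⟩
  · obtain ⟨q, hq, rfl⟩ := Finset.mem_map.1 hp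
    exact hT.1.subset q hq
  · rw [← cost_flip]
    refine hT.1.cost_pos _ ⟨hc.col, hc.row, fun i j => hc.supp j i⟩ (fun i j h => ?_)
      fun h => h0 (congrArg flip h)
    obtain ⟨q, hq, hqij⟩ := Finset.mem_map.1 (hcT j i h)
    have : q = (i, j) := Prod.ext (congrArg Prod.snd hqij) (congrArg Prod.fst hqij)
    rwa [← this]
  · rw [Finset.card_map, hT.2, add_comm]

/-- A hypergraph and its dual have equally many hypertrees. -/
theorem ncard_hypertrees_flip (E : L → R → Prop) (hL : 0 < Fintype.card L)
    (hR : 0 < Fintype.card R) : (hypertrees (flip E)).ncard = (hypertrees E).ncard := by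
  obtain ⟨w, hw⟩ := exists_genericWeight (L := L) (R := R)
  rw [ncard_hypertrees_eq_ncard_optimalTrees hw E hR,
    ncard_hypertrees_eq_ncard_optimalTrees hw.flip (flip E) hL]
  symm
  refine Set.BijOn.ncard_eq (f := fun T => T.map (Equiv.prodComm L R).toEmbedding)
    ⟨fun T hT => map_swap_mem_optimalTrees hT, (Finset.map_injective _).injOn, fun T hT => ?_⟩
  refine ⟨T.map (Equiv.prodComm R L).toEmbedding, map_swap_mem_optimalTrees hT, ?_⟩
  ext p
  simp

end Duality

/-! ### Coordinates on the simplices -/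

section CoordSimplex

theorem mem_coordSimplex {n : ℕ} {I : Set (Fin n)} {p : Fin n → ℝ} :
    p ∈ coordSimplex I ↔ (∀ j, 0 ≤ p j) ∧ ∑ j, p j = 1 ∧ ∀ j, p j ≠ 0 → j ∈ I := by
  constructor
  · suffices coordSimplex I ⊆ {p | (∀ j, 0 ≤ p j) ∧ ∑ j, p j = 1 ∧ ∀ j, p j ≠ 0 → j ∈ I} from
      fun h => this h
    refine convexHull_min ?_ ?_
    · rintro _ ⟨j, hj, rfl⟩
      refine ⟨fun k => ?_, by simp, fun k hk => ?_⟩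
      · by_cases h : k = j
        · subst h; simp
        · simp [h]
      · by_cases h : k = j
        · rwa [h]
        · simp [h] at hk
    · rintro p ⟨hp0, hp1, hpI⟩ q ⟨hq0, hq1, hqI⟩ s t hs ht hst
      refine ⟨fun j => ?_, ?_, fun j hj => ?_⟩
      · exact add_nonneg (mul_nonneg hs (hp0 j)) (mul_nonneg ht (hq0 j))
      · simp [Finset.sum_add_distrib, ← Finset.mul_sum, hp1, hq1, hst]
      · by_contra h
        have h1 : p j = 0 := by
          by_contra h1
          exact h (hpI j h1)
        have h2 : q j = 0 := by
          by_contra h2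
          exact h (hqI j h2)
        simp [h1, h2] at hj
  · classical
    rintro ⟨h0, h1, hI⟩
    have hp : p = ∑ j with j ∈ I, p j • (Pi.single j (1 : ℝ) : Fin n → ℝ) := by
      rw [Finset.sum_filter_of_ne]
      · funext k
        simp [Finset.sum_apply, Pi.single_apply]
      · exact fun j _ h => hI j fun h' => h (by rw [h', zero_smul])
    rw [hp]
    refine (convex_convexHull ℝ _).sum_mem (fun j _ => h0 j) ?_ fun j hj => ?_
    · rw [Finset.sum_filter_of_ne fun j _ h => hI j h, h1]
    · exact subset_convexHull ℝ _ ⟨j, by simpa using hj, rfl⟩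

end CoordSimplex

/-! ### Inequalities for the polytope and its trimming -/

section GenPerm

variable {m n : ℕ} {G : SimpleGraph (Fin m ⊕ Fin n)} {y : Fin m → ℕ}

theorem convex_genPerm : Convex ℝ (genPerm G y) :=
  convex_sum _ fun _ _ => (convex_convexHull ℝ _).smul _

open Classical in
/-- The lower bound for the sum of the coordinates in `S` on the polytope `genPerm G y`. -/
noncomputable def lowerBound (G : SimpleGraph (Fin m ⊕ Fin n)) (y : Fin m → ℕ)
    (S : Finset (Fin n)) : ℕ :=
  ∑ i with nbrs G i ⊆ S, y i

theorem lowerBound_univ : lowerBound G y Finset.univ = ∑ i, y i := by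
  simp [lowerBound]

theorem sum_of_mem_genPerm {x : Fin n → ℝ} (hx : x ∈ genPerm G y) :
    ∑ j, x j = ∑ i, (y i : ℝ) ∧ ∀ S, (lowerBound G y S : ℝ) ≤ ∑ j ∈ S, x j := by
  classical
  obtain ⟨q, hq, rfl⟩ := (Set.mem_fintype_sum _ _).1 hx
  choose p hp hpq using fun i => Set.mem_smul_set.1 (hq i)
  have hp' := fun i => mem_coordSimplex.1 (hp i)
  have hsum : ∀ S : Finset (Fin n), ∑ j ∈ S, (∑ i, q i) j = ∑ i, (y i : ℝ) * ∑ j ∈ S, p i j :=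
    fun S => by
      simp only [Finset.sum_apply, ← hpq, Pi.smul_apply, smul_eq_mul, Finset.mul_sum]
      rw [Finset.sum_comm]
  refine ⟨?_, fun S => ?_⟩
  · rw [hsum]
    exact Finset.sum_congr rfl fun i _ => by rw [(hp' i).2.1, mul_one]
  · rw [hsum, lowerBound, Finset.sum_filter]
    push_cast
    refine Finset.sum_le_sum fun i _ => ?_
    split_ifs with h
    · have : ∑ j ∈ S, p i j = 1 := by
        rw [← (hp' i).2.1]
        refine Finset.sum_subset (Finset.subset_univ S) fun j _ hj => ?_
        by_contra h0
        exact hj (h ((hp' i).2.2 j h0))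
      rw [this, mul_one]
    · exact mul_nonneg (Nat.cast_nonneg _) (Finset.sum_nonneg fun j _ => (hp' i).1 j)

/-- The inequality for the complement of the neighbourhood of `J`, or equivalently for the
neighbourhood itself with all `i ∈ J` contributing, is Hall's condition; the rows of an integral
transport plan are the Minkowski summands. -/
theorem natCast_mem_genPerm (hne : ∀ i, (nbrs G i).Nonempty) {x : Fin n → ℕ}
    (hsum : ∑ j, x j = ∑ i, y i) (hx : ∀ S, lowerBound G y S ≤ ∑ j ∈ S, x j) :
    (fun j => (x j : ℝ)) ∈ genPerm G y := by
  classical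
  obtain ⟨b, hb1, hb2, hb3⟩ := exists_transport (fun i j => j ∈ nbrs G i) y x hsum.symm
    fun J => by
      refine le_trans ?_ ((hx _).trans (le_of_eq (by congr!)))
      refine Finset.sum_le_sum_of_subset fun i hi => ?_
      simp only [Finset.mem_filter, Finset.mem_univ, true_and]
      intro j hj
      simpa using ⟨i, hi, hj⟩
  refine (Set.mem_fintype_sum _ _).2 ⟨fun i j => (b i j : ℝ), fun i => ?_, ?_⟩
  · rcases Nat.eq_zero_or_pos (y i) with h | h
    -- A zero dilate is `{0}` only because the simplex is nonempty.
    · have h0 : (fun j => (b i j : ℝ)) = 0 := by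
        funext j
        have h1 := hb1 i
        rw [h, Finset.sum_eq_zero_iff] at h1
        simp [h1 j (Finset.mem_univ j)]
      show (fun j => (b i j : ℝ)) ∈ _
      rw [h0, h, Nat.cast_zero]
      obtain ⟨j, hj⟩ := hne i
      exact ⟨Pi.single j 1, subset_convexHull ℝ _ ⟨j, hj, rfl⟩, zero_smul ℝ _⟩
    · have hy : (0 : ℝ) < y i := Nat.cast_pos.2 h
      refine ⟨fun j => (b i j : ℝ) / y i, mem_coordSimplex.2 ⟨fun j => by positivity, ?_,
        fun j hj => hb3 i j ?_⟩, ?_⟩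
      · rw [← Finset.sum_div, div_eq_one_iff_eq hy.ne', ← hb1 i]
        push_cast
        rfl
      · rintro h0
        simp [h0] at hj
      · funext j
        simp only [Pi.smul_apply, smul_eq_mul]
        field_simp
  · funext j
    rw [Finset.sum_apply, ← hb2 j]
    push_cast
    rfl

/-- By convexity it suffices to test the translates `z + e_j`. For a proper subset `S`, some `j ∉ S`
leaves the sum over `S` unchanged, so the bound passes to `z` itself. -/
theorem intCast_mem_trimmedGenPerm (hn : 1 ≤ n) (hne : ∀ i, (nbrs G i).Nonempty)
    (z : Fin n → ℤ) : (fun j => (z j : ℝ)) ∈ trimmedGenPerm G y ↔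
      ∑ j, z j + 1 = ∑ i, (y i : ℤ) ∧
        ∀ S ≠ Finset.univ, (lowerBound G y S : ℤ) ≤ ∑ j ∈ S, z j := by
  classical
  have hsingle : ∀ (S : Finset (Fin n)) (j : Fin n),
      ∑ k ∈ S, (z k + if k = j then 1 else 0) = ∑ k ∈ S, z k + if j ∈ S then 1 else 0 :=
    fun S j => by rw [Finset.sum_add_distrib, Finset.sum_ite_eq']
  constructor
  · intro hz
    have hmem : ∀ j : Fin n, (fun k => ((z k + if k = j then 1 else 0 : ℤ) : ℝ)) ∈ genPerm G y :=
      fun j => by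
        refine hz ⟨_, rfl, Pi.single j 1, subset_convexHull ℝ _ ⟨j, Set.mem_univ j, rfl⟩, ?_⟩
        funext k
        by_cases h : k = j
        · subst h; simp
        · simp [h]
    refine ⟨?_, fun S hS => ?_⟩
    · have h1 := (sum_of_mem_genPerm (hmem ⟨0, hn⟩)).1
      have h2 := hsingle Finset.univ ⟨0, hn⟩
      rw [if_pos (Finset.mem_univ _)] at h2
      rw [← h2]
      exact_mod_cast h1
    · obtain ⟨j, hj⟩ : ∃ j, j ∉ S := by
        by_contra! h
        exact hS (Finset.eq_univ_iff_forall.2 h)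
      have h1 := (sum_of_mem_genPerm (hmem j)).2 S
      have h2 := hsingle S j
      rw [if_neg hj, add_zero] at h2
      rw [← h2]
      exact_mod_cast h1
  · rintro ⟨hz1, hz2⟩
    have hmem : ∀ j : Fin n, (fun k => ((z k + if k = j then 1 else 0 : ℤ) : ℝ)) ∈ genPerm G y :=
      fun j => by
        have hS : ∀ S, (lowerBound G y S : ℤ) ≤ ∑ k ∈ S, (z k + if k = j then 1 else 0) :=
          fun S => by
            rw [hsingle]
            by_cases h : S = Finset.univ
            · rw [h, lowerBound_univ, if_pos (Finset.mem_univ _), hz1]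
              push_cast
              rfl
            · have := hz2 S h
              split_ifs <;> omega
        have hnn : ∀ k, 0 ≤ z k + if k = j then 1 else 0 := fun k => by
          have := hS {k}
          rw [Finset.sum_singleton] at this
          omega
        have hcast : ∀ k, (((z k + if k = j then 1 else 0).toNat : ℕ) : ℤ) =
            z k + if k = j then 1 else 0 := fun k => Int.toNat_of_nonneg (hnn k)
        have h := natCast_mem_genPerm (y := y) hne
          (x := fun k => (z k + if k = j then 1 else 0).toNat) ?_ fun S => ?_
        · convert h using 2 with k
          exact_mod_cast (hcast k).symm
        · zify
          simp only [hcast]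
          rw [hsingle, if_pos (Finset.mem_univ _), hz1]
        · zify
          simp only [hcast]
          exact hS S
    have hsub : coordSimplex (Set.univ : Set (Fin n)) ⊆
        (fun p => (fun j => (z j : ℝ)) + p) ⁻¹' genPerm G y := by
      refine convexHull_min ?_ (convex_genPerm.translate_preimage_right _)
      rintro _ ⟨j, -, rfl⟩
      show _ ∈ genPerm G y
      convert hmem j using 1
      funext k
      by_cases h : k = j
      · subst h; simp
      · simp [h]
    rintro _ ⟨_, rfl, p, hp, rfl⟩
    exact hsub hp

/-! ### The blow-up and its hypertrees -/

/-- The neighbour relation of `G` after replacing each left vertex `i` by `y i` copies. -/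
def blowUp (G : SimpleGraph (Fin m ⊕ Fin n)) (y : Fin m → ℕ) :
    (Σ i, Fin (y i)) → Fin n → Prop :=
  fun x j => j ∈ nbrs G x.1

/-- A copy has no neighbour in `S` exactly when its neighbourhood lies in `Sᶜ`. This matches
hypertree upper bounds on `S` with polytope lower bounds on `Sᶜ`. -/
theorem card_blowUp (S : Finset (Fin n))
    {d : DecidablePred fun x => ∃ j ∈ S, flip (blowUp G y) j x} :
    (Finset.univ.filter fun x => ∃ j ∈ S, flip (blowUp G y) j x).card =
      ∑ i, y i - lowerBound G y Sᶜ := by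
  classical
  have h1 : lowerBound G y Sᶜ =
      (Finset.univ.filter fun x => ¬∃ j ∈ S, flip (blowUp G y) j x).card := by
    have h2 : (Finset.univ.filter fun x => ¬∃ j ∈ S, flip (blowUp G y) j x) =
        (Finset.univ.filter fun i => nbrs G i ⊆ ((Sᶜ : Finset (Fin n)) : Set (Fin n))).sigma
          fun i => (Finset.univ : Finset (Fin (y i))) := by
      ext x
      simp only [Finset.mem_filter, Finset.mem_univ, true_and, Finset.mem_sigma, and_true,
        Finset.coe_compl]
      constructor
      · exact fun h j hj hjS => h ⟨j, hjS, hj⟩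
      · rintro h ⟨j, hjS, hj⟩
        exact h hj hjS
    rw [h2]
    simp [lowerBound]
  refine Nat.eq_sub_of_add_eq ?_
  rw [h1, Finset.card_filter_add_card_filter_not]
  simp

theorem finite_hypertrees {L R : Type*} [Fintype L] [Fintype R] (E : L → R → Prop) :
    (hypertrees E).Finite := by
  classical
  refine (Set.finite_Iic (fun _ : L => Fintype.card R)).subset fun a ha i => ?_
  have h1 : a i ≤ ∑ i, a i := Finset.single_le_sum (fun _ _ => Nat.zero_le _) (Finset.mem_univ i)
  have h2 := ha.1
  show a i ≤ Fintype.card R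
  omega

theorem bijOn_hypertrees_latticePoints (hn : 2 ≤ n) (hne : ∀ i, (nbrs G i).Nonempty) :
    Set.BijOn (fun b j => (b j : ℝ)) (hypertrees (flip (blowUp G y)))
      (latticePoints (trimmedGenPerm G y)) := by
  classical
  have hcard : Fintype.card (Σ i, Fin (y i)) = ∑ i, y i := by simp
  refine ⟨fun b hb => ⟨?_, fun j => ⟨b j, by simp⟩⟩, fun b _ b' _ h => ?_, fun x hx => ?_⟩
  · have := (intCast_mem_trimmedGenPerm (y := y) (by omega) hne fun j => (b j : ℤ)).2 ⟨?_, ?_⟩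
    · simpa using this
    · have := hb.1
      rw [hcard] at this
      exact_mod_cast this
    · intro S hS
      have h1 := hb.2 Sᶜ ((Finset.nonempty_iff_ne_empty).2 fun h =>
        hS (Finset.compl_eq_empty_iff S |>.1 h))
      rw [card_blowUp, compl_compl] at h1
      have h3 := Finset.sum_add_sum_compl S b
      have h4 := hb.1
      rw [hcard] at h4
      have h5 : lowerBound G y S ≤ ∑ j ∈ S, b j := by omega
      exact_mod_cast h5
  · funext j
    have := congrFun h j
    simpa using this
  · choose z hz using hx.2
    obtain rfl : x = fun j => (z j : ℝ) := funext hz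
    obtain ⟨h1, h2⟩ := (intCast_mem_trimmedGenPerm (by omega) hne z).1 hx.1
    -- Here `2 ≤ n` is essential: singletons must be proper subsets for the inequalities to apply.
    have hnn : ∀ j, 0 ≤ z j := fun j => by
      have := h2 {j} fun h => by
        have := congrArg Finset.card h
        simp at this
        omega
      rw [Finset.sum_singleton] at this
      omega
    obtain ⟨z, rfl⟩ : ∃ z' : Fin n → ℕ, z = fun j => (z' j : ℤ) :=
      ⟨fun j => (z j).toNat, funext fun j => (Int.toNat_of_nonneg (hnn j)).symm⟩
    dsimp only at h1 h2
    have h5 : ∑ j, z j + 1 = ∑ i, y i := by exact_mod_cast h1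
    refine ⟨z, ⟨?_, fun S hS => ?_⟩, by simp⟩
    · rw [hcard, h5]
    · have h3 := h2 Sᶜ fun h => hS.ne_empty (by simpa using h)
      have h4 : lowerBound G y Sᶜ ≤ ∑ j ∈ Sᶜ, z j := by exact_mod_cast h3
      have h6 := Finset.sum_add_sum_compl S z
      rw [card_blowUp]
      omega

theorem mem_draconianSeqs {a : Fin m → ℕ} : a ∈ draconianSeqs G ↔ IsDraconian G a := by
  simp [draconianSeqs]

open Classical in
theorem ncard_iUnion_nbrs (J : Finset (Fin m)) :
    (⋃ i ∈ J, nbrs G i).ncard = (Finset.univ.filter fun j => ∃ i ∈ J, j ∈ nbrs G i).card := by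
  rw [← Set.ncard_coe_finset]
  congr 1
  ext j
  simp

/-- Copies of a vertex share their neighbours, so enlarging a set of copies to full blocks keeps the
neighbourhood and only increases the sum. -/
theorem mem_hypertrees_blowUp (hne : ∀ i, (nbrs G i).Nonempty) (a : (Σ i, Fin (y i)) → ℕ) :
    a ∈ hypertrees (blowUp G y) ↔ IsDraconian G fun i => ∑ k, a ⟨i, k⟩ := by
  classical
  have hsum : ∑ x, a x = ∑ i, ∑ k, a ⟨i, k⟩ := Fintype.sum_sigma a
  constructor
  · rintro ⟨h1, h2⟩
    refine ⟨by rw [← hsum, h1, Fintype.card_fin], fun J hJ => ?_⟩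
    rw [ncard_iUnion_nbrs]
    have hJsum : ∑ i ∈ J, ∑ k, a ⟨i, k⟩ =
        ∑ x ∈ J.sigma fun i => (Finset.univ : Finset (Fin (y i))), a x :=
      (Finset.sum_sigma _ _ _).symm
    rw [hJsum]
    -- When every `y i` with `i ∈ J` is zero there are no copies to test, and only a nonempty
    -- neighbourhood is needed.
    rcases (J.sigma fun i => (Finset.univ : Finset (Fin (y i)))).eq_empty_or_nonempty with h | h
    · rw [h, Finset.sum_empty, zero_add, Nat.succ_le_iff, Finset.card_pos]
      obtain ⟨i, hi⟩ := hJ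
      obtain ⟨j, hj⟩ := hne i
      exact ⟨j, by simpa using ⟨i, hi, hj⟩⟩
    · refine (h2 _ h).trans (Finset.card_le_card fun j hj => ?_)
      simp only [Finset.mem_filter, Finset.mem_univ, true_and] at hj ⊢
      obtain ⟨x, hx, hxj⟩ := hj
      exact ⟨x.1, (Finset.mem_sigma.1 hx).1, hxj⟩
  · rintro ⟨h1, h2⟩
    refine ⟨by rw [hsum, h1, Fintype.card_fin], fun J hJ => ?_⟩
    have h3 := h2 (J.image Sigma.fst) (hJ.image _)
    rw [ncard_iUnion_nbrs] at h3
    have h4 : ∑ x ∈ J, a x ≤ ∑ i ∈ J.image Sigma.fst, ∑ k, a ⟨i, k⟩ := by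
      rw [← Finset.sum_sigma (J.image Sigma.fst) (fun i => (Finset.univ : Finset (Fin (y i)))) a]
      refine Finset.sum_le_sum_of_subset fun x hx => ?_
      simpa using ⟨x.2, hx⟩
    refine (Nat.succ_le_succ h4).trans (h3.trans (Finset.card_le_card fun j hj => ?_))
    simp only [Finset.mem_filter, Finset.mem_univ, true_and] at hj ⊢
    obtain ⟨i, hi, hij⟩ := hj
    obtain ⟨x, hx, rfl⟩ := Finset.mem_image.1 hi
    exact ⟨x, hx, hij⟩

theorem ncard_sum_eq (k s : ℕ) : {f : Fin k → ℕ | ∑ t, f t = s}.ncard = k.multichoose s := by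
  have h : {f : Fin k → ℕ | ∑ t, f t = s} =
      (fun f : Fin k →₀ ℕ => (f : Fin k → ℕ)) '' ((Finset.univ.finsuppAntidiag s : Finset (Fin k →₀ ℕ)) : Set _) := by
    ext f
    simp only [Set.mem_ofPred_eq, Set.mem_image, Finset.mem_coe, Finset.mem_finsuppAntidiag,
      Finset.subset_univ, and_true]
    constructor
    · exact fun hf => ⟨Finsupp.equivFunOnFinite.symm f, by simpa using hf, by simp⟩
    · rintro ⟨f, hf, rfl⟩
      exact hf
  rw [h, Set.ncard_image_of_injective _ DFunLike.coe_injective, Set.ncard_coe_finset,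
    Finset.card_finsuppAntidiag_nat_eq_multichoose, Finset.card_univ, Fintype.card_fin]

theorem ncard_rowSums_eq (a : Fin m → ℕ) :
    {f : (Σ i, Fin (y i)) → ℕ | ∀ i, ∑ k, f ⟨i, k⟩ = a i}.ncard =
      ∏ i, (y i).multichoose (a i) := by
  have h : (Equiv.piCurry fun _ _ => ℕ) '' {f : (Σ i, Fin (y i)) → ℕ | ∀ i, ∑ k, f ⟨i, k⟩ = a i} =
      Set.univ.pi fun i => {f : Fin (y i) → ℕ | ∑ k, f k = a i} := by
    ext f
    rw [Equiv.image_eq_preimage_symm]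
    simp only [Set.mem_preimage, Set.mem_ofPred_eq, Set.mem_pi, Set.mem_univ, true_implies]
    exact Iff.rfl
  rw [← Set.ncard_image_of_injective _ (Equiv.piCurry fun _ _ => ℕ).injective, h]
  simp only [← ncard_sum_eq, ← Nat.card_coe_set_eq]
  rw [← Nat.card_pi]
  exact Nat.card_congr (Equiv.Set.univPi _)

theorem ncard_hypertrees_blowUp (hne : ∀ i, (nbrs G i).Nonempty) :
    (hypertrees (blowUp G y)).ncard = ∑ a ∈ draconianSeqs G, ∏ i, (y i).multichoose (a i) := by
  classical
  rw [Set.ncard_eq_toFinset_card _ (finite_hypertrees _),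
    Finset.card_eq_sum_card_fiberwise (f := fun a i => ∑ k, a ⟨i, k⟩) (t := draconianSeqs G)]
  · refine Finset.sum_congr rfl fun a ha => ?_
    rw [← ncard_rowSums_eq, ← Set.ncard_coe_finset]
    congr 1
    ext f
    simp only [Finset.coe_filter, Set.Finite.mem_toFinset, mem_hypertrees_blowUp hne,
      Set.mem_ofPred_eq]
    constructor
    · exact fun h i => congrFun h.2 i
    · intro h
      have h' : (fun i => ∑ k, f ⟨i, k⟩) = a := funext h
      exact ⟨by rw [h']; exact mem_draconianSeqs.1 ha, h'⟩
  · intro a ha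
    simp only [Set.Finite.coe_toFinset, mem_hypertrees_blowUp hne] at ha
    exact Finset.mem_coe.2 (mem_draconianSeqs.2 ha)

theorem ncard_latticePoints (hn : 1 ≤ n) (hne : ∀ i, (nbrs G i).Nonempty) :
    (latticePoints (trimmedGenPerm G y)).Finite ∧ (latticePoints (trimmedGenPerm G y)).ncard =
      ∑ a ∈ draconianSeqs G, ∏ i, (y i).multichoose (a i) := by
  classical
  -- For `n = 1` the unique lattice point is `∑ y i - 1`, which is `-1` when `y = 0` and then is no
  -- hypertree; hence the separate case.
  rcases hn.eq_or_lt with rfl | hn2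
  · have h1 : latticePoints (trimmedGenPerm G y) = {fun _ => ((∑ i, (y i : ℤ) - 1 : ℤ) : ℝ)} := by
      ext x
      rw [Set.mem_singleton_iff]
      constructor
      · intro hx
        choose z hz using hx.2
        obtain rfl : x = fun j => (z j : ℝ) := funext hz
        have h1 := ((intCast_mem_trimmedGenPerm le_rfl hne z).1 hx.1).1
        rw [Fin.sum_univ_one] at h1
        funext j
        rw [Subsingleton.elim j 0, ← h1]
        simp
      · rintro rfl
        refine ⟨(intCast_mem_trimmedGenPerm le_rfl hne _).2 ⟨by simp, fun S hS => ?_⟩,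
          fun j => ⟨_, rfl⟩⟩
        obtain rfl : S = ∅ := by
          by_contra h
          obtain ⟨j, hj⟩ := Finset.nonempty_iff_ne_empty.2 h
          exact hS (Finset.eq_univ_iff_forall.2 fun k => by rwa [Subsingleton.elim k j])
        rw [Finset.sum_empty, lowerBound, Finset.filter_false_of_mem]
        · simp
        · intro i _ hi
          obtain ⟨j, hj⟩ := hne i
          simpa using hi hj
    have h2 : draconianSeqs G = {0} := by
      ext a
      rw [mem_draconianSeqs, Finset.mem_singleton]
      constructor
      · intro ha
        have h3 : ∑ i, a i = 0 := by
          have := ha.1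
          omega
        rw [Finset.sum_eq_zero_iff] at h3
        exact funext fun i => h3 i (Finset.mem_univ i)
      · rintro rfl
        refine ⟨by simp, fun J hJ => ?_⟩
        simp only [Pi.zero_apply, Finset.sum_const_zero, zero_add]
        rw [Nat.succ_le_iff, Set.ncard_pos (Set.toFinite _)]
        obtain ⟨i, hi⟩ := hJ
        obtain ⟨j, hj⟩ := hne i
        exact ⟨j, Set.mem_biUnion hi hj⟩
    rw [h1, h2]
    simp
  · have hbij := bijOn_hypertrees_latticePoints (y := y) hn2 hne
    refine ⟨hbij.image_eq ▸ (finite_hypertrees _).image _, ?_⟩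
    rw [← hbij.ncard_eq, ← ncard_hypertrees_blowUp hne]
    -- Duality needs both sides nonempty; with no copies, both counts are zero since `n ≥ 2`.
    rcases Nat.eq_zero_or_pos (Fintype.card (Σ i, Fin (y i))) with h | h
    · have h1 : hypertrees (flip (blowUp G y)) = ∅ :=
        Set.eq_empty_of_forall_notMem fun b hb => by
          have := hb.1
          omega
      have h2 : hypertrees (blowUp G y) = ∅ :=
        Set.eq_empty_of_forall_notMem fun a ha => by
          have := ha.1
          have := Fintype.card_eq_zero_iff.1 h
          simp at *
          omega
      rw [h1, h2, Set.ncard_empty, Set.ncard_empty]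
    · exact ncard_hypertrees_flip _ h (by rw [Fintype.card_fin]; omega)

end GenPerm

end GenPermutohedron

theorem theorem4p3 (m n : ℕ) (hn : 1 ≤ n) (G : SimpleGraph (Fin m ⊕ Fin n))
    (hG : G ≤ completeBipartiteGraph (Fin m) (Fin n))
    (hiso : ∀ v, ∃ w, G.Adj v w) (y : Fin m → ℕ) :
    (GenPermutohedron.latticePoints (GenPermutohedron.trimmedGenPerm G y)).Finite ∧
      ((GenPermutohedron.latticePoints (GenPermutohedron.trimmedGenPerm G y)).ncard : ℚ) =
        ∑ a ∈ GenPermutohedron.draconianSeqs G,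
          ∏ i, ((y i).ascFactorial (a i) : ℚ) / ((a i).factorial : ℚ) := by
  have hne : ∀ i, (GenPermutohedron.nbrs G i).Nonempty := fun i => by
    obtain ⟨w | j, hw⟩ := hiso (Sum.inl i)
    · have := hG hw
      simp at this
    · exact ⟨j, hw⟩
  obtain ⟨h1, h2⟩ := GenPermutohedron.ncard_latticePoints (y := y) hn hne
  refine ⟨h1, ?_⟩
  rw [h2]
  push_cast
  refine Finset.sum_congr rfl fun a _ => Finset.prod_congr rfl fun i _ => ?_
  rw [Nat.multichoose_eq, Nat.ascFactorial_eq_factorial_mul_choose', eq_div_iff]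
  · push_cast
    ring
  · exact_mod_cast Nat.factorial_ne_zero _
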